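/- Let $\lambda>0$ and let $\mu$ be the measure $d\mu(t)=\operatorname{sh}^{2\lambda}t\,dt$ on $[0,\infty)$ (here $\operatorname{sh}$, $\operatorname{ch}$ are the hyperbolic sine and cosine). For $r>0$ put $H(0,r)=(-r,r)\cap[0,\infty)=[0,r)$ and $|H(0,r)|_\lambda=\mu(H(0,r))=\int_0^r\operatorname{sh}^{2\lambda}t\,dt$. For $1\le p\le\infty$ let $L_{p,\lambda}[0,\infty)$ be the space of real- or complex-valued functions $f$ on $[1,\infty)$ such that $t\mapsto f(\operatorname{ch}t)$ is measurable on $[0,\infty)$ and has finite norm $\left(\int_0^\infty|f(\operatorname{ch}t)|^p\operatorname{sh}^{2\lambda}t\,dt\right)^{1/p}$ if $p<\infty$, respectively $\operatorname{ess\,sup}_{t\ge0}|f(\operatorname{ch}t)|$ if $p=\infty$. For $x,t\ge0$ define the generalized (Gegenbauer) shift $$A^\lambda_{\operatorname{ch}t}f(\operatorname{ch}x)=\frac{\Gamma(\lambda+\frac12)}{\Gamma(\frac12)\Gamma(\lambda)}\int_0^\pi f(\operatorname{ch}x\operatorname{ch}t-\operatorname{sh}x\operatorname{sh}t\cos\varphi)(\sin\varphi)^{2\lambda-1}\,d\varphi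 .$$ If $f\in L_{p,\lambda}[0,\infty)$ with $1\le p\le\infty$, then for almost every $x\in[0,\infty)$ the integral defining $A^\lambda_{\operatorname{ch}t}f(\operatorname{ch}x)$ converges absolutely for almost every $t\ge0$, the function $t\mapsto A^\lambda_{\operatorname{ch}t}f(\operatorname{ch}x)$ is $\mu$-integrable on $H(0,r)$ for every $r>0$, and $$\lim_{r\to0+}\frac1{|H(0,r)|_\lambda}\int_{H(0,r)}A^\lambda_{\operatorname{ch}t}f(\operatorname{ch}x)\,\operatorname{sh}^{2\lambda}t\,dt=f(\operatorname{ch}x).$$ -/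

import Mathlib

open MeasureTheory Filter Topology Set
open scoped ENNReal

/-- The set `H(x, r) = (x - r, x + r) ∩ [0, ∞)`. -/
def gegenbauerH (x r : ℝ) : Set ℝ := Ioo (x - r) (x + r) ∩ Ici 0

/-- The measure `dμ(t) = sh^{2λ} t dt` on the half-line `[0, ∞)`, so that `|E|_λ = μ(E)`. -/
noncomputable def gegenbauerMeasure (lam : ℝ) : Measure ℝ :=
  (volume.restrict (Ici 0)).withDensity
    (fun t => ENNReal.ofReal (Real.sinh t ^ (2 * lam)))

/-- Membership in `L_{p,λ}[0, ∞)`: the function `t ↦ f (ch t)` is measurable on `[0, ∞)` and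
has finite `p`-norm with respect to `sh^{2λ} t dt` (essential supremum for `p = ∞`).
Only the values of `f` on `[1, ∞)` matter. -/
def MemGegenbauerLp {𝕜 : Type*} [RCLike 𝕜] (lam : ℝ) (p : ℝ≥0∞) (f : ℝ → 𝕜) : Prop :=
  MemLp (fun t => f (Real.cosh t)) p (gegenbauerMeasure lam)

/-- The integrand (in the angle `φ`) of the generalized shift,
`f (ch x ch t - sh x sh t cos φ) (sin φ)^{2λ-1}`. -/
noncomputable def gegenbauerShiftIntegrand {𝕜 : Type*} [RCLike 𝕜] (lam : ℝ) (f : ℝ → 𝕜)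
    (t x φ : ℝ) : 𝕜 :=
  (Real.sin φ ^ (2 * lam - 1)) •
    f (Real.cosh x * Real.cosh t - Real.sinh x * Real.sinh t * Real.cos φ)

/-- The generalized (Gegenbauer) shift `A^λ_{ch t} f (ch x)`. -/
noncomputable def gegenbauerShift {𝕜 : Type*} [RCLike 𝕜] (lam : ℝ) (f : ℝ → 𝕜) (t x : ℝ) : 𝕜 :=
  (Real.Gamma (lam + 1 / 2) / (Real.Gamma (1 / 2) * Real.Gamma lam)) •
    ∫ φ in (0 : ℝ)..Real.pi, gegenbauerShiftIntegrand lam f t x φ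

/-!
By the hyperbolic law of cosines, `A^λ_{ch t} f (ch x)` is the expectation of `f ∘ cosh` under the
law `κ(t, ·)` of the third side of a hyperbolic triangle with sides `x` and `t` enclosing a random
angle. The Markov kernel `κ` is reversible with respect to `μ`: in polar coordinates around `(1, 0)`
the product of `μ` with the law of the angle is the measure `(u² - 1 - v²)^(λ - 1) du dv` up to a
constant. This measure is invariant under the Lorentz reflection that exchanges `(1, 0)` with
`(cosh x, sinh x)`, and the reflection exchanges the distances to these two points, that is, `t` and
the third side.

By reversibility, the average of the shift over `H(0, r)` is the integral of `f (cosh t)` against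
`κ(t, H(0, r)) / μ(H(0, r)) dμ(t)`. This weight has total mass one, vanishes off `|t - x| ≤ r` by
the triangle inequality, and is at most a constant over `μ([x - r, x + r])`, because a third side
shorter than `r` forces an angle `O(r)`, which has probability `O(r^(2λ))`, while
`μ([x - r, x + r]) = O(r)` and `μ(H(0, r)) ≥ r^(2λ + 1) / (2λ + 1)`. Hence the averages converge to
`f (cosh x)` at every Lebesgue point `x > 0` of `f ∘ cosh`.
-/

section

open Real ProbabilityTheory Metric

section General

lemma map_withDensity_comp {α β : Type*} [MeasurableSpace α] [MeasurableSpace β] (μ : Measure α)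
    {Φ : α → β} (hΦ : Measurable Φ) {w : β → ℝ≥0∞} (hw : Measurable w) :
    (μ.withDensity (w ∘ Φ)).map Φ = (μ.map Φ).withDensity w := by
  ext s hs
  rw [Measure.map_apply hΦ hs, withDensity_apply _ (hΦ hs), withDensity_apply _ hs,
    setLIntegral_map hs hw hΦ]
  rfl

lemma lintegral_Ioc_rpow {s b : ℝ} (hs : -1 < s) (hb : 0 ≤ b) :
    ∫⁻ t in Ioc 0 b, ENNReal.ofReal (t ^ s) = ENNReal.ofReal (b ^ (s + 1) / (s + 1)) := by
  have hint : IntegrableOn (fun t : ℝ => t ^ s) (Ioc 0 b) :=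
    (intervalIntegrable_iff_integrableOn_Ioc_of_le hb).1
      (intervalIntegral.intervalIntegrable_rpow' hs)
  have hnonneg : 0 ≤ᵐ[volume.restrict (Ioc 0 b)] fun t : ℝ => t ^ s := by
    filter_upwards [ae_restrict_mem measurableSet_Ioc] with t ht using rpow_nonneg ht.1.le s
  rw [← ofReal_integral_eq_lintegral_ofReal hint hnonneg, ← intervalIntegral.integral_of_le hb,
    integral_rpow (.inl hs), zero_rpow (by linarith), sub_zero]

variable {E : Type*} [NormedAddCommGroup E] [NormedSpace ℝ E]

lemma norm_integral_smul_sub_le [CompleteSpace E] {α : Type*} [MeasurableSpace α] {μ : Measure α}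
    {B : Set α} (hμB : μ B ≠ ∞) {k : α → ℝ} (hk : ∫ y, k y ∂μ = 1)
    (hk0 : ∀ᵐ y ∂μ, y ∉ B → k y = 0) {D : ℝ} (hkD : ∀ᵐ y ∂μ.restrict B, ‖k y‖ ≤ D)
    {g : α → E} (hg : IntegrableOn g B μ) (a : E) :
    ‖∫ y, k y • g y ∂μ - a‖ ≤ D * ∫ y in B, ‖g y - a‖ ∂μ := by
  have hga : IntegrableOn (fun y => g y - a) B μ := hg.sub (integrableOn_const hμB)
  have hkB : ∫ y in B, k y ∂μ = 1 := by rw [setIntegral_eq_integral_of_ae_compl_eq_zero hk0, hk]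
  have hkgB : ∫ y, k y • g y ∂μ = ∫ y in B, k y • g y ∂μ := by
    refine (setIntegral_eq_integral_of_ae_compl_eq_zero ?_).symm
    filter_upwards [hk0] with y hy hyB
    rw [hy hyB, zero_smul]
  have hka : ∫ y in B, k y • a ∂μ = a := by rw [integral_smul_const, hkB, one_smul]
  have hkint : IntegrableOn k B μ := (integrable_of_integral_eq_one hk).integrableOn
  have hkg : IntegrableOn (fun y => k y • g y) B μ := hg.bdd_smul D hkint.1 hkD
  calc ‖∫ y, k y • g y ∂μ - a‖ = ‖∫ y in B, k y • (g y - a) ∂μ‖ := by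
        simp_rw [smul_sub]
        rw [integral_sub hkg (hkint.smul_const a), hka, hkgB]
    _ ≤ ∫ y in B, D * ‖g y - a‖ ∂μ := by
        refine norm_integral_le_of_norm_le (hga.norm.const_mul D) ?_
        filter_upwards [hkD] with y hy
        rw [norm_smul]
        gcongr
    _ = D * ∫ y in B, ‖g y - a‖ ∂μ := integral_const_mul _ _

end General

section Reversible

variable {α : Type*} [MeasurableSpace α] {μ : Measure α} {κ : Kernel α α} {s : Set α}

lemma comp_restrict_of_isReversible (h : κ.IsReversible μ) (hs : MeasurableSet s) :
    κ ∘ₘ μ.restrict s = μ.withDensity fun y => κ y s := by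
  ext A hA
  rw [Measure.bind_apply hA κ.aemeasurable, withDensity_apply _ hA, h hs hA]

variable {E : Type*} [NormedAddCommGroup E] [NormedSpace ℝ E] {g : α → E}

lemma integrable_comp_restrict_iff_of_isReversible [IsFiniteKernel κ] (h : κ.IsReversible μ)
    (hs : MeasurableSet s) :
    Integrable g (κ ∘ₘ μ.restrict s) ↔ Integrable (fun y => (κ y).real s • g y) μ := by
  rw [comp_restrict_of_isReversible h hs,
    integrable_withDensity_iff_integrable_smul' (κ.measurable_coe hs)
      (ae_of_all _ fun _ => measure_lt_top _ _)]
  rfl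

variable [IsFiniteKernel κ]

lemma integrableOn_integral_of_isReversible (h : κ.IsReversible μ) (hs : MeasurableSet s)
    (hg : Integrable (fun y => (κ y).real s • g y) μ) :
    IntegrableOn (fun t => ∫ y, g y ∂κ t) s μ := by
  rw [← integrable_comp_restrict_iff_of_isReversible h hs, Measure.comp_eq_comp_const_apply] at hg
  exact hg.integral_comp

lemma setIntegral_integral_of_isReversible (h : κ.IsReversible μ) (hs : MeasurableSet s)
    (hg : Integrable (fun y => (κ y).real s • g y) μ) :
    ∫ t in s, ∫ y, g y ∂κ t ∂μ = ∫ y, (κ y).real s • g y ∂μ := by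
  calc ∫ t in s, ∫ y, g y ∂κ t ∂μ = ∫ y, g y ∂(κ ∘ₘ μ.restrict s) := by
        rw [← integrable_comp_restrict_iff_of_isReversible h hs,
          Measure.comp_eq_comp_const_apply] at hg
        rw [Measure.comp_eq_comp_const_apply, Kernel.integral_comp hg, Kernel.const_apply]
    _ = ∫ y, (κ y).real s • g y ∂μ := by
        rw [comp_restrict_of_isReversible h hs,
          integral_withDensity_eq_integral_toReal_smul (κ.measurable_coe hs)
            (ae_of_all _ fun _ => measure_lt_top _ _)]
        rfl

end Reversible

section Angle

/-- The normalizing constant `Γ(λ + 1/2) / (Γ(1/2) Γ(λ))` of the Gegenbauer shift. -/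
noncomputable def gegenbauerConst (lam : ℝ) : ℝ :=
  Gamma (lam + 1 / 2) / (Gamma (1 / 2) * Gamma lam)

/-- The normalized measure proportional to `(sin φ) ^ (2λ - 1) dφ` on `(0, π)`: for `0 < λ`, the law
of the random angle over which the Gegenbauer shift averages. -/
noncomputable def gegenbauerAngleMeasure (lam : ℝ) : Measure ℝ :=
  (volume.restrict (Ioo 0 π)).withDensity
    fun φ => ENNReal.ofReal (gegenbauerConst lam * sin φ ^ (2 * lam - 1))

instance (lam : ℝ) : SFinite (gegenbauerAngleMeasure lam) := by
  unfold gegenbauerAngleMeasure; infer_instance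

variable {lam : ℝ}

lemma gegenbauerConst_pos (hlam : 0 < lam) : 0 < gegenbauerConst lam :=
  div_pos (Gamma_pos_of_pos (by positivity))
    (mul_pos (Gamma_pos_of_pos (by positivity)) (Gamma_pos_of_pos hlam))

lemma gegenbauerConst_eq_div_beta (hlam : 0 < lam) :
    gegenbauerConst lam = 2 ^ (1 - 2 * lam) / beta lam lam := by
  have hdup := Gamma_mul_Gamma_add_half lam
  rw [gegenbauerConst, beta, Gamma_one_half_eq, ← two_mul]
  generalize Gamma (lam + 1 / 2) = G at hdup ⊢
  field_simp
  linear_combination hdup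

lemma ae_gegenbauerAngleMeasure_mem_Ioo (lam : ℝ) :
    ∀ᵐ φ ∂gegenbauerAngleMeasure lam, φ ∈ Ioo 0 π :=
  withDensity_absolutelyContinuous _ _ (ae_restrict_mem measurableSet_Ioo)

lemma measurable_gegenbauerAngleDensity (lam : ℝ) :
    Measurable fun φ => ENNReal.ofReal (gegenbauerConst lam * sin φ ^ (2 * lam - 1)) := by
  fun_prop

lemma image_one_sub_cos_div_two : (fun φ => (1 - cos φ) / 2) '' Ioo 0 π = Ioo 0 1 := by
  apply Subset.antisymm
  · rintro _ ⟨φ, hφ, rfl⟩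
    have hsin := sin_pos_of_mem_Ioo hφ
    have hsq := sin_sq_add_cos_sq φ
    constructor <;> dsimp only <;> nlinarith
  · rintro y ⟨h0, h1⟩
    refine ⟨arccos (1 - 2 * y), ⟨arccos_pos.2 (by linarith), ?_⟩, ?_⟩
    · exact (arccos_le_pi _).lt_of_ne fun h => by linarith [arccos_eq_pi.1 h]
    · dsimp only
      rw [cos_arccos (by linarith) (by linarith)]
      ring

/-- The substitution `y = (1 - cos φ) / 2` turns the Beta density into the angular density. -/
lemma sin_div_two_mul_betaPDFReal (hlam : 0 < lam) {φ : ℝ} (hφ : φ ∈ Ioo 0 π) :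
    sin φ / 2 * (1 / beta lam lam * ((1 - cos φ) / 2) ^ (lam - 1) *
      (1 - (1 - cos φ) / 2) ^ (lam - 1)) = gegenbauerConst lam * sin φ ^ (2 * lam - 1) := by
  have hsin := sin_pos_of_mem_Ioo hφ
  have hsq := sin_sq_add_cos_sq φ
  have hprod : (1 - cos φ) / 2 * (1 - (1 - cos φ) / 2) = (sin φ / 2) ^ (2 : ℝ) := by
    rw [rpow_two]
    linear_combination -hsq / 4
  have hpow : (sin φ / 2) * (sin φ / 2) ^ (2 * (lam - 1)) =
      2 ^ (1 - 2 * lam) * sin φ ^ (2 * lam - 1) := by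
    rw [mul_comm, ← rpow_add_one (by positivity), div_rpow hsin.le zero_le_two,
      show 2 * (lam - 1) + 1 = 2 * lam - 1 by ring, ← neg_sub (2 * lam), rpow_neg zero_le_two]
    ring
  rw [mul_assoc (1 / _), ← mul_rpow (by nlinarith) (by nlinarith), hprod,
    ← rpow_mul (by positivity), gegenbauerConst_eq_div_beta hlam]
  linear_combination (1 / beta lam lam) * hpow

lemma isProbabilityMeasure_gegenbauerAngleMeasure (hlam : 0 < lam) :
    IsProbabilityMeasure (gegenbauerAngleMeasure lam) := by
  have hderiv (φ : ℝ) : HasDerivAt (fun φ => (1 - cos φ) / 2) (sin φ / 2) φ := by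
    simpa using ((hasDerivAt_cos φ).const_sub 1).div_const 2
  have hinj : InjOn (fun φ => (1 - cos φ) / 2) (Ioo 0 π) := fun φ hφ ψ hψ h =>
    injOn_cos (Ioo_subset_Icc_self hφ) (Ioo_subset_Icc_self hψ) (by linarith)
  refine ⟨?_⟩
  rw [gegenbauerAngleMeasure, withDensity_apply _ .univ, Measure.restrict_univ,
    ← lintegral_betaPDF_eq_one hlam hlam, lintegral_betaPDF, ← image_one_sub_cos_div_two,
    lintegral_image_eq_lintegral_abs_deriv_mul measurableSet_Ioo
      (fun φ _ => (hderiv φ).hasDerivWithinAt) hinj]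
  refine setLIntegral_congr_fun measurableSet_Ioo fun φ hφ => ?_
  have hsin := sin_pos_of_mem_Ioo hφ
  rw [abs_of_pos (by positivity), ← ENNReal.ofReal_mul (by positivity),
    sin_div_two_mul_betaPDFReal hlam hφ]

lemma exists_sin_rpow_le_mul_rpow (a : ℝ) :
    ∃ K, 0 ≤ K ∧ ∀ θ ∈ Ioc 0 (π / 2), sin θ ^ a ≤ K * θ ^ a := by
  rcases le_total 0 a with ha | ha
  · refine ⟨1, zero_le_one, fun θ ⟨h0, h1⟩ => ?_⟩
    rw [one_mul]
    exact rpow_le_rpow (sin_nonneg_of_nonneg_of_le_pi h0.le (by linarith)) (sin_le h0.le) ha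
  · refine ⟨(2 / π) ^ a, by positivity, fun θ ⟨h0, h1⟩ => ?_⟩
    rw [← mul_rpow (by positivity) h0.le]
    exact rpow_le_rpow_of_nonpos (by positivity) (mul_le_sin h0.le h1) ha

lemma exists_gegenbauerAngleMeasure_Iic_le_of_le_pi_div_two (hlam : 0 < lam) :
    ∃ K, ∀ δ ∈ Icc 0 (π / 2), (gegenbauerAngleMeasure lam).real (Iic δ) ≤ K * δ ^ (2 * lam) := by
  have hc := gegenbauerConst_pos hlam
  obtain ⟨K, hK, hsin⟩ := exists_sin_rpow_le_mul_rpow (2 * lam - 1)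
  refine ⟨gegenbauerConst lam * K / (2 * lam), fun δ ⟨h0, h1⟩ => ?_⟩
  refine ENNReal.toReal_le_of_le_ofReal (by positivity) ?_
  rw [gegenbauerAngleMeasure, withDensity_apply _ measurableSet_Iic,
    Measure.restrict_restrict measurableSet_Iic]
  calc ∫⁻ θ in Iic δ ∩ Ioo 0 π, ENNReal.ofReal (gegenbauerConst lam * sin θ ^ (2 * lam - 1))
      ≤ ∫⁻ θ in Ioc 0 δ, ENNReal.ofReal (gegenbauerConst lam * sin θ ^ (2 * lam - 1)) :=
        lintegral_mono_set fun θ hθ => ⟨hθ.2.1, hθ.1⟩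
    _ ≤ ∫⁻ θ in Ioc 0 δ, ENNReal.ofReal (gegenbauerConst lam * K) *
          ENNReal.ofReal (θ ^ (2 * lam - 1)) := by
        refine setLIntegral_mono' measurableSet_Ioc fun θ hθ => ?_
        rw [← ENNReal.ofReal_mul (by positivity), mul_assoc]
        gcongr
        exact hsin θ ⟨hθ.1, hθ.2.trans h1⟩
    _ = ENNReal.ofReal (gegenbauerConst lam * K / (2 * lam) * δ ^ (2 * lam)) := by
        rw [lintegral_const_mul _ (by fun_prop), lintegral_Ioc_rpow (by linarith) h0,
          ← ENNReal.ofReal_mul (by positivity), sub_add_cancel]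
        ring_nf

lemma exists_gegenbauerAngleMeasure_Iic_le (hlam : 0 < lam) :
    ∃ K, 0 ≤ K ∧ ∀ δ, 0 ≤ δ → (gegenbauerAngleMeasure lam).real (Iic δ) ≤ K * δ ^ (2 * lam) := by
  have := isProbabilityMeasure_gegenbauerAngleMeasure hlam
  obtain ⟨K, hK⟩ := exists_gegenbauerAngleMeasure_Iic_le_of_le_pi_div_two hlam
  refine ⟨max K 1, by positivity, fun δ h0 => ?_⟩
  rcases le_total δ (π / 2) with hδ | hδ
  · exact (hK δ ⟨h0, hδ⟩).trans (by gcongr; exact le_max_left K 1)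
  · have hone : 1 ≤ δ ^ (2 * lam) := one_le_rpow (by linarith [two_le_pi]) (by positivity)
    calc (gegenbauerAngleMeasure lam).real (Iic δ) ≤ 1 := measureReal_le_one
      _ ≤ max K 1 * δ ^ (2 * lam) := one_le_mul_of_one_le_of_one_le (le_max_right K 1) hone

end Angle

section Kernel

/-- The side opposite to the angle `φ` between sides `x` and `t` of a hyperbolic triangle, given by
the hyperbolic law of cosines; the Gegenbauer shift evaluates `f ∘ cosh` at this side. -/
noncomputable def oppositeSide (x t φ : ℝ) : ℝ :=
  arcosh (cosh x * cosh t - sinh x * sinh t * cos φ)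

lemma one_le_hyperbolic_law_of_cosines (x t φ : ℝ) :
    1 ≤ cosh x * cosh t - sinh x * sinh t * cos φ := by
  have hcos : sinh x * sinh t * cos φ ≤ |sinh x * sinh t| := by
    calc sinh x * sinh t * cos φ ≤ |sinh x * sinh t| * |cos φ| := by
          rw [← abs_mul]; exact le_abs_self _
      _ ≤ |sinh x * sinh t| := mul_le_of_le_one_right (abs_nonneg _) (abs_cos_le_one φ)
  have hcosh : cosh (|x| - |t|) = cosh x * cosh t - |sinh x * sinh t| := by
    rw [cosh_sub, cosh_abs, cosh_abs, ← abs_sinh, ← abs_sinh, abs_mul]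
  linarith [one_le_cosh (|x| - |t|)]

lemma cosh_oppositeSide (x t φ : ℝ) :
    cosh (oppositeSide x t φ) = cosh x * cosh t - sinh x * sinh t * cos φ :=
  cosh_arcosh (one_le_hyperbolic_law_of_cosines x t φ)

lemma oppositeSide_nonneg (x t φ : ℝ) : 0 ≤ oppositeSide x t φ :=
  arcosh_nonneg (one_le_hyperbolic_law_of_cosines x t φ)

lemma cosh_oppositeSide_eq_cosh_sub_add (x t φ : ℝ) :
    cosh (oppositeSide x t φ) = cosh (x - t) + sinh x * sinh t * (1 - cos φ) := by
  rw [cosh_oppositeSide, cosh_sub]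
  ring

lemma abs_sub_le_oppositeSide {x t : ℝ} (hx : 0 ≤ x) (ht : 0 ≤ t) (φ : ℝ) :
    |x - t| ≤ oppositeSide x t φ := by
  have hsinh := mul_nonneg (sinh_nonneg_iff.2 hx) (sinh_nonneg_iff.2 ht)
  have hcos := cos_le_one φ
  rw [← abs_of_nonneg (oppositeSide_nonneg x t φ), ← cosh_le_cosh,
    cosh_oppositeSide_eq_cosh_sub_add]
  nlinarith

lemma measurable_arcosh : Measurable arcosh := by
  unfold arcosh
  fun_prop

lemma measurable_uncurry_oppositeSide (x : ℝ) : Measurable (Function.uncurry (oppositeSide x)) := by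
  have := measurable_arcosh
  unfold oppositeSide Function.uncurry
  fun_prop

lemma measurable_oppositeSide (x t : ℝ) : Measurable (oppositeSide x t) :=
  (measurable_uncurry_oppositeSide x).of_uncurry_left

/-- The transition kernel sending `t` to the law of the opposite side of a hyperbolic triangle
with sides `x` and `t` and random angle distributed by `gegenbauerAngleMeasure`. -/
noncomputable def gegenbauerKernel (lam x : ℝ) : Kernel ℝ ℝ :=
  (Kernel.id ×ₖ Kernel.const ℝ (gegenbauerAngleMeasure lam)).map
    (Function.uncurry (oppositeSide x))

lemma gegenbauerKernel_apply (lam x t : ℝ) :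
    gegenbauerKernel lam x t = (gegenbauerAngleMeasure lam).map (oppositeSide x t) := by
  have hm := measurable_uncurry_oppositeSide x
  rw [gegenbauerKernel, Kernel.map_apply _ hm, Kernel.prod_apply, Kernel.id_apply,
    Kernel.const_apply, Measure.dirac_prod, Measure.map_map hm measurable_prodMk_left]
  rfl

lemma isMarkovKernel_gegenbauerKernel {lam : ℝ} (hlam : 0 < lam) (x : ℝ) :
    IsMarkovKernel (gegenbauerKernel lam x) := by
  have := isProbabilityMeasure_gegenbauerAngleMeasure hlam
  exact Kernel.IsMarkovKernel.map _ (measurable_uncurry_oppositeSide x)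

variable {𝕜 : Type*} [RCLike 𝕜]

lemma intervalIntegrable_gegenbauerShiftIntegrand {lam : ℝ} (hlam : 0 < lam) {f : ℝ → 𝕜} {x t : ℝ}
    (hf : Integrable (fun s => f (cosh s)) (gegenbauerKernel lam x t)) :
    IntervalIntegrable (gegenbauerShiftIntegrand lam f t x) volume 0 π := by
  rw [gegenbauerKernel_apply] at hf
  have hangle := hf.comp_measurable (measurable_oppositeSide x t)
  rw [gegenbauerAngleMeasure, integrable_withDensity_iff_integrable_smul'
    (measurable_gegenbauerAngleDensity lam) (ae_of_all _ fun _ => ENNReal.ofReal_lt_top)] at hangle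
  rw [intervalIntegrable_iff_integrableOn_Ioo_of_le pi_pos.le]
  refine (hangle.smul (gegenbauerConst lam)⁻¹).congr ?_
  filter_upwards [ae_restrict_mem measurableSet_Ioo] with φ hφ
  have hc := gegenbauerConst_pos hlam
  have hsin := sin_pos_of_mem_Ioo hφ
  simp only [Pi.smul_apply, Function.comp_apply]
  rw [ENNReal.toReal_ofReal (by positivity), smul_smul, inv_mul_cancel_left₀ hc.ne',
    cosh_oppositeSide]
  rfl

lemma gegenbauerShift_eq_integral {lam : ℝ} (hlam : 0 < lam) {f : ℝ → 𝕜} {x t : ℝ}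
    (hf : AEStronglyMeasurable (fun s => f (cosh s)) (gegenbauerKernel lam x t)) :
    gegenbauerShift lam f t x = ∫ s, f (cosh s) ∂gegenbauerKernel lam x t := by
  rw [gegenbauerKernel_apply] at hf ⊢
  rw [integral_map (measurable_oppositeSide x t).aemeasurable hf, gegenbauerAngleMeasure,
    integral_withDensity_eq_integral_toReal_smul (measurable_gegenbauerAngleDensity lam)
      (ae_of_all _ fun _ => ENNReal.ofReal_lt_top), gegenbauerShift,
    intervalIntegral.integral_of_le pi_pos.le, integral_Ioc_eq_integral_Ioo, ← integral_smul]
  refine setIntegral_congr_fun measurableSet_Ioo fun φ hφ => ?_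
  have hc := gegenbauerConst_pos hlam
  have hsin := sin_pos_of_mem_Ioo hφ
  rw [ENNReal.toReal_ofReal (by positivity), cosh_oppositeSide, mul_smul]
  rfl

end Kernel

section HalfLine

variable {lam : ℝ}

lemma gegenbauerMeasure_eq_restrict_Ioi (lam : ℝ) :
    gegenbauerMeasure lam = (volume.restrict (Ioi 0)).withDensity
      fun t => ENNReal.ofReal (sinh t ^ (2 * lam)) := by
  rw [gegenbauerMeasure, restrict_Ioi_eq_restrict_Ici]

lemma measurable_gegenbauerDensity (lam : ℝ) :
    Measurable fun t => ENNReal.ofReal (sinh t ^ (2 * lam)) := by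
  fun_prop

instance (lam : ℝ) : SFinite (gegenbauerMeasure lam) := by
  unfold gegenbauerMeasure; infer_instance

lemma ae_gegenbauerMeasure_pos (lam : ℝ) : ∀ᵐ t ∂gegenbauerMeasure lam, 0 < t := by
  rw [gegenbauerMeasure_eq_restrict_Ioi]
  exact withDensity_absolutelyContinuous _ _ (ae_restrict_mem measurableSet_Ioi)

lemma restrict_Ici_absolutelyContinuous_gegenbauerMeasure (lam : ℝ) :
    volume.restrict (Ici 0) ≪ gegenbauerMeasure lam := by
  rw [gegenbauerMeasure_eq_restrict_Ioi, ← restrict_Ioi_eq_restrict_Ici]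
  refine withDensity_absolutelyContinuous' (measurable_gegenbauerDensity lam).aemeasurable ?_
  filter_upwards [ae_restrict_mem measurableSet_Ioi] with t ht
  have := sinh_pos_iff.2 ht
  exact (ENNReal.ofReal_pos.2 (by positivity)).ne'

lemma isLocallyFiniteMeasure_gegenbauerMeasure (hlam : 0 < lam) :
    IsLocallyFiniteMeasure (gegenbauerMeasure lam) :=
  IsLocallyFiniteMeasure.withDensity_ofReal
    (continuous_sinh.rpow_const fun _ => .inr (by positivity))

lemma gegenbauerH_zero (r : ℝ) : gegenbauerH 0 r = Ico 0 r := by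
  ext t
  simp only [gegenbauerH, zero_sub, zero_add, mem_inter_iff, mem_Ioo, mem_Ici, mem_Ico]
  grind

lemma measurableSet_gegenbauerH (x r : ℝ) : MeasurableSet (gegenbauerH x r) :=
  measurableSet_Ioo.inter measurableSet_Ici

lemma gegenbauerMeasure_gegenbauerH_ne_top (hlam : 0 < lam) (r : ℝ) :
    gegenbauerMeasure lam (gegenbauerH 0 r) ≠ ∞ := by
  have := isLocallyFiniteMeasure_gegenbauerMeasure hlam
  rw [gegenbauerH_zero]
  exact measure_Ico_lt_top.ne

lemma le_gegenbauerMeasure_gegenbauerH {r : ℝ} (hlam : 0 < lam) (hr : 0 ≤ r) :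
    r ^ (2 * lam + 1) / (2 * lam + 1) ≤ (gegenbauerMeasure lam).real (gegenbauerH 0 r) := by
  rw [measureReal_def,
    ← ENNReal.ofReal_le_iff_le_toReal (gegenbauerMeasure_gegenbauerH_ne_top hlam r),
    gegenbauerH_zero, gegenbauerMeasure_eq_restrict_Ioi, withDensity_apply _ measurableSet_Ico,
    Measure.restrict_restrict measurableSet_Ico]
  calc ENNReal.ofReal (r ^ (2 * lam + 1) / (2 * lam + 1))
      = ∫⁻ t in Ioo 0 r, ENNReal.ofReal (t ^ (2 * lam)) := by
        rw [restrict_Ioo_eq_restrict_Ioc, lintegral_Ioc_rpow (by linarith) hr]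
    _ ≤ ∫⁻ t in Ioo 0 r, ENNReal.ofReal (sinh t ^ (2 * lam)) :=
        setLIntegral_mono' measurableSet_Ioo fun t ht => ENNReal.ofReal_le_ofReal
          (rpow_le_rpow ht.1.le (self_le_sinh_iff.2 ht.1.le) (by positivity))
    _ ≤ ∫⁻ t in Ico 0 r ∩ Ioi 0, ENNReal.ofReal (sinh t ^ (2 * lam)) :=
        lintegral_mono_set fun t ht => ⟨⟨ht.1.le, ht.2⟩, ht.1⟩

lemma gegenbauerMeasure_gegenbauerH_pos {r : ℝ} (hlam : 0 < lam) (hr : 0 < r) :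
    0 < (gegenbauerMeasure lam).real (gegenbauerH 0 r) :=
  lt_of_lt_of_le (by positivity) (le_gegenbauerMeasure_gegenbauerH hlam hr.le)

lemma gegenbauerMeasure_closedBall_le {x r : ℝ} (hlam : 0 < lam) (hr : 0 ≤ r)
    (hxr : 0 ≤ x + r) :
    (gegenbauerMeasure lam).real (closedBall x r) ≤ sinh (x + r) ^ (2 * lam) * (2 * r) := by
  refine ENNReal.toReal_le_of_le_ofReal (by positivity) ?_
  rw [gegenbauerMeasure, withDensity_apply _ measurableSet_closedBall,
    Measure.restrict_restrict measurableSet_closedBall, closedBall_eq_Icc]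
  calc ∫⁻ t in Icc (x - r) (x + r) ∩ Ici 0, ENNReal.ofReal (sinh t ^ (2 * lam))
      ≤ ∫⁻ _ in Icc (x - r) (x + r) ∩ Ici 0, ENNReal.ofReal (sinh (x + r) ^ (2 * lam)) :=
        setLIntegral_mono' (measurableSet_Icc.inter measurableSet_Ici) fun t ht =>
          ENNReal.ofReal_le_ofReal (rpow_le_rpow (sinh_nonneg_iff.2 ht.2)
            (sinh_le_sinh.2 ht.1.2) (by positivity))
    _ ≤ ENNReal.ofReal (sinh (x + r) ^ (2 * lam)) * volume (Icc (x - r) (x + r)) := by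
        rw [setLIntegral_const]
        gcongr
        exact inter_subset_left
    _ = ENNReal.ofReal (sinh (x + r) ^ (2 * lam) * (2 * r)) := by
        rw [volume_Icc, ← ENNReal.ofReal_mul (by positivity)]
        ring_nf

end HalfLine

section Reversibility

variable (lam x : ℝ)

/-- The hyperboloid coordinates `(u, v)` with `1 < u` and `v ^ 2 < u ^ 2 - 1`: the points `(u, v)`
are the projections of the upper half of `u ^ 2 - v ^ 2 - w ^ 2 = 1` off the axis `w = 0`. -/
def hyperbolicRegion : Set (ℝ × ℝ) := {q | 1 < q.1 ∧ q.2 ^ 2 < q.1 ^ 2 - 1}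

/-- The measure proportional to `(u ^ 2 - 1 - v ^ 2) ^ (λ - 1) du dv` on the hyperbolic region. Its
density depends on the Lorentz form `u ^ 2 - v ^ 2` only. -/
noncomputable def lorentzMeasure : Measure (ℝ × ℝ) :=
  (volume.restrict hyperbolicRegion).withDensity
    fun q => ENNReal.ofReal (gegenbauerConst lam * (q.1 ^ 2 - 1 - q.2 ^ 2) ^ (lam - 1))

/-- The Lorentz reflection that exchanges `(1, 0)` with the point `(cosh x, sinh x)` at hyperbolic
distance `x` from it. -/
noncomputable def lorentzReflection : ℝ × ℝ →ₗ[ℝ] ℝ × ℝ :=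
  Matrix.toLin (.finTwoProd ℝ) (.finTwoProd ℝ) !![cosh x, -sinh x; sinh x, -cosh x]

/-- Geodesic polar coordinates around `(1, 0)`. -/
noncomputable def hyperbolicPolar (p : ℝ × ℝ) : ℝ × ℝ := (cosh p.1, sinh p.1 * cos p.2)

/-- The derivative of `hyperbolicPolar`. -/
noncomputable def hyperbolicPolarDeriv (p : ℝ × ℝ) : ℝ × ℝ →L[ℝ] ℝ × ℝ :=
  (Matrix.toLin (.finTwoProd ℝ) (.finTwoProd ℝ)
    !![sinh p.1, 0; cosh p.1 * cos p.2, -(sinh p.1 * sin p.2)]).toContinuousLinearMap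

lemma measurableSet_hyperbolicRegion : MeasurableSet hyperbolicRegion := by
  unfold hyperbolicRegion
  measurability

lemma measurable_lorentzDensity : Measurable fun q : ℝ × ℝ =>
    ENNReal.ofReal (gegenbauerConst lam * (q.1 ^ 2 - 1 - q.2 ^ 2) ^ (lam - 1)) := by
  fun_prop

lemma lorentzReflection_apply (q : ℝ × ℝ) : lorentzReflection x q =
    (cosh x * q.1 - sinh x * q.2, sinh x * q.1 - cosh x * q.2) := by
  rw [lorentzReflection, Matrix.toLin_finTwoProd_apply]
  ext <;> simp only <;> ring

lemma measurable_lorentzReflection : Measurable (lorentzReflection x) :=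
  (lorentzReflection x).continuous_of_finiteDimensional.measurable

lemma lorentzReflection_involutive : Function.Involutive (lorentzReflection x) := by
  intro q
  have h := cosh_sq x
  ext <;> simp only [lorentzReflection_apply]
  · linear_combination q.1 * h
  · linear_combination q.2 * h

lemma lorentzReflection_sq_sub_sq (q : ℝ × ℝ) :
    (lorentzReflection x q).1 ^ 2 - 1 - (lorentzReflection x q).2 ^ 2 =
      q.1 ^ 2 - 1 - q.2 ^ 2 := by
  simp only [lorentzReflection_apply]
  linear_combination (q.1 ^ 2 - q.2 ^ 2) * cosh_sq x

lemma lorentzReflection_mem_hyperbolicRegion {q : ℝ × ℝ} (hq : q ∈ hyperbolicRegion) :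
    lorentzReflection x q ∈ hyperbolicRegion := by
  obtain ⟨h1, h2⟩ := hq
  have hform := lorentzReflection_sq_sub_sq x q
  have hpos : 0 < (lorentzReflection x q).1 := by
    have hsq : (sinh x * q.2) ^ 2 < (cosh x * q.1) ^ 2 := by
      rw [mul_pow, mul_pow, cosh_sq]
      nlinarith [sq_nonneg (sinh x)]
    have hlt := abs_lt_of_sq_lt_sq hsq (mul_nonneg (cosh_pos x).le (by linarith))
    simp only [lorentzReflection_apply]
    linarith [le_abs_self (sinh x * q.2)]
  constructor <;> nlinarith [sq_nonneg (lorentzReflection x q).2]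

lemma preimage_lorentzReflection_hyperbolicRegion :
    lorentzReflection x ⁻¹' hyperbolicRegion = hyperbolicRegion := by
  refine Subset.antisymm (fun q hq => ?_) fun q hq => lorentzReflection_mem_hyperbolicRegion x hq
  rw [← lorentzReflection_involutive x q]
  exact lorentzReflection_mem_hyperbolicRegion x hq

lemma map_lorentzReflection_volume : (volume : Measure (ℝ × ℝ)).map (lorentzReflection x) =
    volume := by
  have hdet : LinearMap.det (lorentzReflection x) = -1 := by
    rw [lorentzReflection, LinearMap.det_toLin, Matrix.det_fin_two_of]
    linear_combination -cosh_sq x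
  rw [Measure.map_linearMap_addHaar_eq_smul_addHaar _ (by rw [hdet]; norm_num), hdet]
  norm_num

theorem map_lorentzReflection_lorentzMeasure :
    (lorentzMeasure lam).map (lorentzReflection x) = lorentzMeasure lam := by
  have hL := measurable_lorentzReflection x
  have hdensity :
      (fun q : ℝ × ℝ => ENNReal.ofReal (gegenbauerConst lam *
        (q.1 ^ 2 - 1 - q.2 ^ 2) ^ (lam - 1))) ∘ lorentzReflection x =
      fun q => ENNReal.ofReal (gegenbauerConst lam * (q.1 ^ 2 - 1 - q.2 ^ 2) ^ (lam - 1)) := by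
    funext q
    simp only [Function.comp_apply, lorentzReflection_sq_sub_sq]
  rw [lorentzMeasure, ← hdensity, map_withDensity_comp _ hL (measurable_lorentzDensity lam),
    hdensity]
  nth_rw 1 [← preimage_lorentzReflection_hyperbolicRegion x]
  rw [← Measure.restrict_map hL measurableSet_hyperbolicRegion, map_lorentzReflection_volume]

lemma measurable_hyperbolicPolar : Measurable hyperbolicPolar := by
  unfold hyperbolicPolar
  fun_prop

lemma hasFDerivAt_hyperbolicPolar (p : ℝ × ℝ) :
    HasFDerivAt hyperbolicPolar (hyperbolicPolarDeriv p) p := by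
  rw [hyperbolicPolarDeriv, Matrix.toLin_finTwoProd_toContinuousLinearMap]
  convert! HasFDerivAt.prodMk (𝕜 := ℝ)
      ((hasDerivAt_cosh p.1).comp_hasFDerivAt p hasFDerivAt_fst)
      (((hasDerivAt_sinh p.1).comp_hasFDerivAt p hasFDerivAt_fst).mul
        ((hasDerivAt_cos p.2).comp_hasFDerivAt p hasFDerivAt_snd)) using 2
  · simp
  · simp only [smul_smul, Function.comp_apply]
    rw [add_comm, mul_comm (cosh p.1), mul_neg]

lemma det_hyperbolicPolarDeriv (p : ℝ × ℝ) :
    (hyperbolicPolarDeriv p).det = -(sinh p.1 ^ 2 * sin p.2) := by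
  rw [hyperbolicPolarDeriv, LinearMap.det_toContinuousLinearMap, LinearMap.det_toLin,
    Matrix.det_fin_two_of]
  ring

lemma measurable_det_hyperbolicPolarDeriv :
    Measurable fun p => (hyperbolicPolarDeriv p).det := by
  simp only [det_hyperbolicPolarDeriv]
  fun_prop

lemma injOn_hyperbolicPolar : InjOn hyperbolicPolar (Ioi 0 ×ˢ Ioo 0 π) := by
  rintro ⟨t, φ⟩ ⟨ht, hφ⟩ ⟨s, ψ⟩ ⟨hs, hψ⟩ h
  simp only [hyperbolicPolar, Prod.mk.injEq] at h
  obtain rfl : t = s := cosh_injOn (mem_Ioi.1 ht).le (mem_Ioi.1 hs).le h.1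
  have hcos := mul_left_cancel₀ (sinh_pos_iff.2 ht).ne' h.2
  exact Prod.ext rfl (injOn_cos (Ioo_subset_Icc_self hφ) (Ioo_subset_Icc_self hψ) hcos)

lemma hyperbolicPolar_sq_sub_sq (p : ℝ × ℝ) :
    (hyperbolicPolar p).1 ^ 2 - 1 - (hyperbolicPolar p).2 ^ 2 = (sinh p.1 * sin p.2) ^ 2 := by
  simp only [hyperbolicPolar]
  linear_combination cosh_sq p.1 - sinh p.1 ^ 2 * sin_sq_add_cos_sq p.2

lemma image_hyperbolicPolar : hyperbolicPolar '' (Ioi 0 ×ˢ Ioo 0 π) = hyperbolicRegion := by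
  apply Subset.antisymm
  · rintro _ ⟨p, ⟨ht, hφ⟩, rfl⟩
    have hsinh := sinh_pos_iff.2 ht
    have hsin := sin_pos_of_mem_Ioo hφ
    have hform := hyperbolicPolar_sq_sub_sq p
    have hpos : 0 < (sinh p.1 * sin p.2) ^ 2 := by positivity
    exact ⟨one_lt_cosh.2 (mem_Ioi.1 ht).ne', by linarith⟩
  · rintro ⟨u, v⟩ ⟨h1, h2⟩
    dsimp only at h1 h2
    have hs : 0 < √(u ^ 2 - 1) := sqrt_pos.2 (by nlinarith)
    have hsq : √(u ^ 2 - 1) ^ 2 = u ^ 2 - 1 := sq_sqrt (by nlinarith)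
    have habs : |v / √(u ^ 2 - 1)| < 1 := by
      rw [abs_div, abs_of_pos hs, div_lt_one hs]
      exact abs_lt_of_sq_lt_sq (by rwa [hsq]) hs.le
    obtain ⟨ha, hb⟩ := abs_lt.1 habs
    refine ⟨(arcosh u, arccos (v / √(u ^ 2 - 1))), ⟨arcosh_pos h1, arccos_pos.2 hb, ?_⟩, ?_⟩
    · exact (arccos_le_pi _).lt_of_ne fun h => by linarith [arccos_eq_pi.1 h]
    · simp only [hyperbolicPolar, cosh_arcosh h1.le, sinh_arcosh h1.le, cos_arccos ha.le hb.le]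
      rw [mul_div_cancel₀ _ hs.ne']

lemma rpow_two_mul_mul_rpow_two_mul_sub_one {a b : ℝ} (ha : 0 < a) (hb : 0 < b) :
    a ^ (2 * lam) * b ^ (2 * lam - 1) = a ^ 2 * b * ((a * b) ^ 2) ^ (lam - 1) := by
  rw [← rpow_two (a * b), ← rpow_mul (by positivity), mul_rpow ha.le hb.le,
    show 2 * lam = 2 * (lam - 1) + 2 by ring, rpow_add ha, rpow_two,
    show 2 * (lam - 1) + 2 - 1 = 2 * (lam - 1) + 1 by ring, rpow_add_one hb.ne']
  ring

theorem map_hyperbolicPolar_prod :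
    ((gegenbauerMeasure lam).prod (gegenbauerAngleMeasure lam)).map hyperbolicPolar =
      lorentzMeasure lam := by
  set w : ℝ × ℝ → ℝ≥0∞ := fun q =>
    ENNReal.ofReal (gegenbauerConst lam * (q.1 ^ 2 - 1 - q.2 ^ 2) ^ (lam - 1))
  have hw : Measurable w := measurable_lorentzDensity lam
  have hP := measurable_hyperbolicPolar
  have hS : MeasurableSet (Ioi (0 : ℝ) ×ˢ Ioo 0 π) := measurableSet_Ioi.prod measurableSet_Ioo
  have hdet := measurable_det_hyperbolicPolarDeriv
  have hprod : (gegenbauerMeasure lam).prod (gegenbauerAngleMeasure lam) =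
      ((volume.restrict (Ioi 0 ×ˢ Ioo 0 π)).withDensity
        fun p => ENNReal.ofReal |(hyperbolicPolarDeriv p).det|).withDensity
          (w ∘ hyperbolicPolar) := by
    rw [gegenbauerMeasure_eq_restrict_Ioi, gegenbauerAngleMeasure,
      prod_withDensity (measurable_gegenbauerDensity lam) (measurable_gegenbauerAngleDensity lam),
      Measure.prod_restrict, ← Measure.volume_eq_prod,
      ← withDensity_mul _ (by fun_prop) (hw.comp hP)]
    refine withDensity_congr_ae ?_
    filter_upwards [ae_restrict_mem hS] with p hp
    have hsinh := sinh_pos_iff.2 hp.1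
    have hsin := sin_pos_of_mem_Ioo hp.2
    simp only [Pi.mul_apply, Function.comp_apply, w, hyperbolicPolar_sq_sub_sq]
    rw [det_hyperbolicPolarDeriv, abs_neg, abs_of_pos (by positivity),
      ← ENNReal.ofReal_mul (by positivity), ← ENNReal.ofReal_mul (by positivity)]
    congr 1
    linear_combination
      gegenbauerConst lam * rpow_two_mul_mul_rpow_two_mul_sub_one lam hsinh hsin
  rw [hprod, map_withDensity_comp _ hP hw, map_withDensity_abs_det_fderiv_eq_addHaar volume
    hS.nullMeasurableSet (fun p _ => (hasFDerivAt_hyperbolicPolar p).hasFDerivWithinAt)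
    injOn_hyperbolicPolar, image_hyperbolicPolar, lorentzMeasure]

/-- The distances of the point with hyperboloid coordinates `q` to the points `(1, 0)` and
`(cosh x, sinh x)`. -/
noncomputable def hyperbolicDistances (q : ℝ × ℝ) : ℝ × ℝ :=
  (arcosh q.1, arcosh (lorentzReflection x q).1)

lemma measurable_hyperbolicDistances : Measurable (hyperbolicDistances x) :=
  (measurable_arcosh.comp measurable_fst).prodMk
    (measurable_arcosh.comp (measurable_fst.comp (measurable_lorentzReflection x)))

lemma hyperbolicDistances_lorentzReflection (q : ℝ × ℝ) :
    hyperbolicDistances x (lorentzReflection x q) = (hyperbolicDistances x q).swap := by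
  rw [hyperbolicDistances, lorentzReflection_involutive x q]
  rfl

lemma hyperbolicDistances_hyperbolicPolar {t : ℝ} (ht : 0 ≤ t) (φ : ℝ) :
    hyperbolicDistances x (hyperbolicPolar (t, φ)) = (t, oppositeSide x t φ) := by
  simp only [hyperbolicDistances, hyperbolicPolar, lorentzReflection_apply, arcosh_cosh ht,
    oppositeSide, mul_assoc]

lemma setLIntegral_gegenbauerKernel {A B : Set ℝ} (hA : MeasurableSet A) (hB : MeasurableSet B) :
    ∫⁻ t in A, gegenbauerKernel lam x t B ∂gegenbauerMeasure lam =
      lorentzMeasure lam (hyperbolicDistances x ⁻¹' (A ×ˢ B)) := by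
  have hP := measurable_hyperbolicPolar
  have hD := measurable_hyperbolicDistances x (hA.prod hB)
  rw [← map_hyperbolicPolar_prod, Measure.map_apply hP hD, Measure.prod_apply (hP hD),
    ← lintegral_indicator hA]
  refine lintegral_congr_ae ?_
  filter_upwards [ae_gegenbauerMeasure_pos lam] with t ht
  have hfiber : Prod.mk t ⁻¹' (hyperbolicPolar ⁻¹' (hyperbolicDistances x ⁻¹' (A ×ˢ B))) =
      {φ | t ∈ A ∧ oppositeSide x t φ ∈ B} := by
    ext φ
    simp only [mem_preimage, hyperbolicDistances_hyperbolicPolar x ht.le, mem_prod]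
    rfl
  rw [hfiber]
  by_cases htA : t ∈ A
  · rw [indicator_of_mem htA, gegenbauerKernel_apply,
      Measure.map_apply (measurable_oppositeSide x t) hB]
    simp only [htA, true_and]
    rfl
  · simp only [htA, not_false_eq_true, indicator_of_notMem, false_and]
    exact measure_empty.symm

theorem isReversible_gegenbauerKernel :
    (gegenbauerKernel lam x).IsReversible (gegenbauerMeasure lam) := by
  intro A B hA hB
  rw [setLIntegral_gegenbauerKernel lam x hA hB, setLIntegral_gegenbauerKernel lam x hB hA]
  nth_rw 2 [← map_lorentzReflection_lorentzMeasure lam x]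
  rw [Measure.map_apply (measurable_lorentzReflection x)
    (measurable_hyperbolicDistances x (hB.prod hA))]
  congr 1
  ext q
  simp only [mem_preimage, hyperbolicDistances_lorentzReflection, mem_prod, Prod.fst_swap,
    Prod.snd_swap]
  exact and_comm

end Reversibility

section Concentration

lemma cosh_sub_one_le_sq {r : ℝ} (hr : |r| ≤ 1) : cosh r - 1 ≤ r ^ 2 := by
  have hsq : |r ^ 2 / 2| ≤ 1 := by
    rw [abs_of_nonneg (by positivity)]
    linarith [(sq_le_one_iff_abs_le_one r).2 hr]
  have hexp := (le_abs_self _).trans (abs_exp_sub_one_le hsq)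
  rw [abs_of_nonneg (by positivity)] at hexp
  linarith [cosh_le_exp_half_sq r]

lemma angle_le_of_oppositeSide_le {x t φ r : ℝ} (hx : 0 < x) (ht : 0 < t) (hφ : φ ∈ Ioo 0 π)
    (hr : r ≤ 1) (h : oppositeSide x t φ ≤ r) : φ ≤ π / √(2 * (sinh x * sinh t)) * r := by
  have hr0 : 0 ≤ r := (oppositeSide_nonneg x t φ).trans h
  have hS : 0 < sinh x * sinh t := mul_pos (sinh_pos_iff.2 hx) (sinh_pos_iff.2 ht)
  have hcos : 2 / π ^ 2 * φ ^ 2 ≤ 1 - cos φ := by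
    linarith [cos_le_one_sub_mul_cos_sq (x := φ) (by rw [abs_of_pos hφ.1]; exact hφ.2.le)]
  have hcosh : sinh x * sinh t * (1 - cos φ) ≤ r ^ 2 := by
    have hle : cosh (oppositeSide x t φ) ≤ cosh r :=
      cosh_le_cosh.2 (abs_le_abs_of_nonneg (oppositeSide_nonneg x t φ) h)
    rw [cosh_oppositeSide_eq_cosh_sub_add] at hle
    linarith [one_le_cosh (x - t), cosh_sub_one_le_sq (abs_le.2 ⟨by linarith, hr⟩)]
  have hsq : (φ * √(2 * (sinh x * sinh t))) ^ 2 ≤ (π * r) ^ 2 := by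
    have hle := (mul_le_mul_of_nonneg_left hcos hS.le).trans hcosh
    rw [div_mul_eq_mul_div, mul_div_assoc', div_le_iff₀ (by positivity)] at hle
    rw [mul_pow, sq_sqrt (by positivity)]
    linarith
  rw [div_mul_eq_mul_div, le_div_iff₀ (by positivity)]
  exact le_of_sq_le_sq hsq (by positivity)

variable {lam x : ℝ}

lemma gegenbauerKernel_gegenbauerH_eq_zero {t r : ℝ} (hx : 0 ≤ x) (ht : 0 ≤ t)
    (h : r ≤ |x - t|) : (gegenbauerKernel lam x t).real (gegenbauerH 0 r) = 0 := by
  have hempty : oppositeSide x t ⁻¹' Ico 0 r = ∅ :=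
    eq_empty_of_forall_notMem fun φ hφ =>
      (h.trans (abs_sub_le_oppositeSide hx ht φ)).not_gt hφ.2
  rw [gegenbauerH_zero, gegenbauerKernel_apply,
    map_measureReal_apply (measurable_oppositeSide x t) measurableSet_Ico, hempty,
    measureReal_empty]

lemma ae_gegenbauerKernel_gegenbauerH_eq_zero (hx : 0 ≤ x) (r : ℝ) :
    ∀ᵐ t ∂gegenbauerMeasure lam, t ∉ closedBall x r →
      (gegenbauerKernel lam x t).real (gegenbauerH 0 r) = 0 := by
  filter_upwards [ae_gegenbauerMeasure_pos lam] with t ht htr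
  rw [mem_closedBall', dist_eq, not_le] at htr
  exact gegenbauerKernel_gegenbauerH_eq_zero hx ht.le htr.le

lemma exists_gegenbauerKernel_gegenbauerH_le (hlam : 0 < lam) (hx : 0 < x) :
    ∃ C, 0 ≤ C ∧ ∀ r ∈ Icc 0 1, ∀ t, x / 2 ≤ t →
      (gegenbauerKernel lam x t).real (gegenbauerH 0 r) ≤ C * r ^ (2 * lam) := by
  have := isProbabilityMeasure_gegenbauerAngleMeasure hlam
  obtain ⟨K, hK, hcap⟩ := exists_gegenbauerAngleMeasure_Iic_le hlam
  refine ⟨K * (π / √(2 * (sinh x * sinh (x / 2)))) ^ (2 * lam), by positivity,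
    fun r ⟨hr0, hr1⟩ t ht => ?_⟩
  rw [gegenbauerKernel_apply, gegenbauerH_zero,
    map_measureReal_apply (measurable_oppositeSide x t) measurableSet_Ico, mul_assoc,
    ← mul_rpow (by positivity) hr0]
  refine le_trans (ENNReal.toReal_mono (measure_ne_top _ _) (measure_mono_ae ?_))
    (hcap _ (by positivity))
  filter_upwards [ae_gegenbauerAngleMeasure_mem_Ioo lam] with φ hφ hside
  calc φ ≤ π / √(2 * (sinh x * sinh t)) * r :=
        angle_le_of_oppositeSide_le hx (by linarith) hφ hr1 hside.2.le
    _ ≤ π / √(2 * (sinh x * sinh (x / 2))) * r := by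
        gcongr
        exact sinh_le_sinh.2 ht

lemma rpow_mul_gegenbauerMeasure_closedBall_le {r : ℝ} (hlam : 0 < lam) (hr : 0 < r)
    (hrx : r ≤ x) :
    r ^ (2 * lam) * (gegenbauerMeasure lam).real (closedBall x r) ≤
      2 * (2 * lam + 1) * sinh (2 * x) ^ (2 * lam) *
        (gegenbauerMeasure lam).real (gegenbauerH 0 r) := by
  have := sinh_nonneg_iff.2 (show 0 ≤ x + r by linarith)
  calc r ^ (2 * lam) * (gegenbauerMeasure lam).real (closedBall x r)
      ≤ r ^ (2 * lam) * (sinh (x + r) ^ (2 * lam) * (2 * r)) := by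
        gcongr
        exact gegenbauerMeasure_closedBall_le hlam hr.le (by linarith)
    _ ≤ r ^ (2 * lam) * (sinh (2 * x) ^ (2 * lam) * (2 * r)) := by
        gcongr
        exact sinh_le_sinh.2 (by linarith)
    _ = 2 * (2 * lam + 1) * sinh (2 * x) ^ (2 * lam) * (r ^ (2 * lam + 1) / (2 * lam + 1)) := by
        rw [rpow_add_one hr.ne']
        field_simp
    _ ≤ _ := by
        have := sinh_nonneg_iff.2 (show 0 ≤ 2 * x by linarith)
        gcongr
        exact le_gegenbauerMeasure_gegenbauerH hlam hr.le

end Concentration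

section Averages

variable {lam x r : ℝ} {E : Type*} [NormedAddCommGroup E] [NormedSpace ℝ E] {g : ℝ → E}

lemma integrable_gegenbauerKernel_smul (hlam : 0 < lam)
    (hg : LocallyIntegrable g (gegenbauerMeasure lam)) (hx : 0 ≤ x) (r : ℝ) :
    Integrable (fun t => (gegenbauerKernel lam x t).real (gegenbauerH 0 r) • g t)
      (gegenbauerMeasure lam) := by
  have := isMarkovKernel_gegenbauerKernel hlam x
  have hk : Measurable fun t => (gegenbauerKernel lam x t).real (gegenbauerH 0 r) :=
    ((gegenbauerKernel lam x).measurable_coe (measurableSet_gegenbauerH 0 r)).ennreal_toReal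
  have hball : IntegrableOn g (closedBall x r) (gegenbauerMeasure lam) :=
    hg.integrableOn_isCompact (isCompact_closedBall x r)
  refine IntegrableOn.integrable_of_ae_notMem_eq_zero (s := closedBall x r) ?_ ?_
  · refine hball.bdd_smul 1 hk.aestronglyMeasurable (ae_of_all _ fun t => ?_)
    rw [norm_of_nonneg measureReal_nonneg]
    exact measureReal_le_one
  · filter_upwards [ae_gegenbauerKernel_gegenbauerH_eq_zero hx r] with t ht htr
    rw [ht htr, zero_smul]

lemma integral_gegenbauerKernel_gegenbauerH (hlam : 0 < lam) (hx : 0 ≤ x) (r : ℝ) :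
    ∫ t, (gegenbauerKernel lam x t).real (gegenbauerH 0 r) ∂gegenbauerMeasure lam =
      (gegenbauerMeasure lam).real (gegenbauerH 0 r) := by
  have := isLocallyFiniteMeasure_gegenbauerMeasure hlam
  have := isMarkovKernel_gegenbauerKernel hlam x
  have h := setIntegral_integral_of_isReversible (isReversible_gegenbauerKernel lam x)
    (measurableSet_gegenbauerH 0 r)
    (integrable_gegenbauerKernel_smul hlam (locallyIntegrable_const (1 : ℝ)) hx r)
  simpa using h.symm

lemma ae_integrable_gegenbauerKernel (hlam : 0 < lam)
    (hg : LocallyIntegrable g (gegenbauerMeasure lam)) (hx : 0 ≤ x) :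
    ∀ᵐ t ∂gegenbauerMeasure lam, Integrable g (gegenbauerKernel lam x t) := by
  have := isMarkovKernel_gegenbauerKernel hlam x
  have hbdd (n : ℕ) : ∀ᵐ t ∂gegenbauerMeasure lam, t ∈ gegenbauerH 0 n →
      Integrable g (gegenbauerKernel lam x t) := by
    rw [← ae_restrict_iff' (measurableSet_gegenbauerH 0 n)]
    exact Measure.ae_integrable_of_integrable_comp
      ((integrable_comp_restrict_iff_of_isReversible (isReversible_gegenbauerKernel lam x)
        (measurableSet_gegenbauerH 0 n)).2 (integrable_gegenbauerKernel_smul hlam hg hx n))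
  filter_upwards [ae_all_iff.2 hbdd, ae_gegenbauerMeasure_pos lam] with t hint ht
  obtain ⟨n, hn⟩ := exists_nat_gt t
  exact hint n (by rw [gegenbauerH_zero]; exact ⟨ht.le, hn⟩)

variable {𝕜 : Type*} [RCLike 𝕜] {f : ℝ → 𝕜}

lemma ae_gegenbauerShift_eq_integral (hlam : 0 < lam)
    (hf : LocallyIntegrable (fun t => f (cosh t)) (gegenbauerMeasure lam)) (hx : 0 ≤ x) :
    (fun t => gegenbauerShift lam f t x) =ᵐ[gegenbauerMeasure lam]
      fun t => ∫ s, f (cosh s) ∂gegenbauerKernel lam x t := by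
  filter_upwards [ae_integrable_gegenbauerKernel hlam hf hx] with t ht
    using gegenbauerShift_eq_integral hlam ht.aestronglyMeasurable

lemma integrableOn_gegenbauerShift (hlam : 0 < lam)
    (hf : LocallyIntegrable (fun t => f (cosh t)) (gegenbauerMeasure lam)) (hx : 0 ≤ x) (r : ℝ) :
    IntegrableOn (fun t => gegenbauerShift lam f t x) (gegenbauerH 0 r)
      (gegenbauerMeasure lam) := by
  have := isMarkovKernel_gegenbauerKernel hlam x
  exact (integrableOn_integral_of_isReversible (isReversible_gegenbauerKernel lam x)
    (measurableSet_gegenbauerH 0 r) (integrable_gegenbauerKernel_smul hlam hf hx r)).congr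
    (ae_restrict_of_ae (ae_gegenbauerShift_eq_integral hlam hf hx).symm)

lemma setIntegral_gegenbauerShift (hlam : 0 < lam)
    (hf : LocallyIntegrable (fun t => f (cosh t)) (gegenbauerMeasure lam)) (hx : 0 ≤ x) (r : ℝ) :
    ∫ t in gegenbauerH 0 r, gegenbauerShift lam f t x ∂gegenbauerMeasure lam =
      ∫ t, (gegenbauerKernel lam x t).real (gegenbauerH 0 r) • f (cosh t)
        ∂gegenbauerMeasure lam := by
  have := isMarkovKernel_gegenbauerKernel hlam x
  rw [integral_congr_ae (ae_restrict_of_ae (ae_gegenbauerShift_eq_integral hlam hf hx))]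
  exact setIntegral_integral_of_isReversible (isReversible_gegenbauerKernel lam x)
    (measurableSet_gegenbauerH 0 r) (integrable_gegenbauerKernel_smul hlam hf hx r)

lemma norm_average_gegenbauerShift_sub_le {C : ℝ} (hlam : 0 < lam)
    (hf : LocallyIntegrable (fun t => f (cosh t)) (gegenbauerMeasure lam)) (hr : 0 < r)
    (hrx : r ≤ x / 2) (hC : ∀ t, x / 2 ≤ t →
      (gegenbauerKernel lam x t).real (gegenbauerH 0 r) ≤ C) (a : 𝕜) :
    ‖((gegenbauerMeasure lam).real (gegenbauerH 0 r))⁻¹ •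
        ∫ t in gegenbauerH 0 r, gegenbauerShift lam f t x ∂gegenbauerMeasure lam - a‖ ≤
      ((gegenbauerMeasure lam).real (gegenbauerH 0 r))⁻¹ * C *
        ∫ t in closedBall x r, ‖f (cosh t) - a‖ ∂gegenbauerMeasure lam := by
  have := isLocallyFiniteMeasure_gegenbauerMeasure hlam
  have hm := gegenbauerMeasure_gegenbauerH_pos hlam hr
  have hx : 0 ≤ x := by linarith
  rw [setIntegral_gegenbauerShift hlam hf hx, ← integral_smul]
  simp_rw [← mul_smul]
  refine norm_integral_smul_sub_le measure_closedBall_lt_top.ne ?_ ?_ ?_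
    (hf.integrableOn_isCompact (isCompact_closedBall x r)) a
  · rw [integral_const_mul, integral_gegenbauerKernel_gegenbauerH hlam hx,
      inv_mul_cancel₀ hm.ne']
  · filter_upwards [ae_gegenbauerKernel_gegenbauerH_eq_zero hx r] with t ht htr
    rw [ht htr, mul_zero]
  · filter_upwards [ae_restrict_mem measurableSet_closedBall] with t ht
    rw [closedBall_eq_Icc] at ht
    rw [norm_of_nonneg (by positivity)]
    gcongr
    exact hC t (by linarith [ht.1])

lemma exists_norm_average_gegenbauerShift_sub_le (hlam : 0 < lam)
    (hf : LocallyIntegrable (fun t => f (cosh t)) (gegenbauerMeasure lam)) (hx : 0 < x) (a : 𝕜) :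
    ∃ M, ∀ r ∈ Ioc 0 (min 1 (x / 2)),
      ‖((gegenbauerMeasure lam).real (gegenbauerH 0 r))⁻¹ •
          ∫ t in gegenbauerH 0 r, gegenbauerShift lam f t x ∂gegenbauerMeasure lam - a‖ ≤
        M * ⨍ t in closedBall x r, ‖f (cosh t) - a‖ ∂gegenbauerMeasure lam := by
  have := isLocallyFiniteMeasure_gegenbauerMeasure hlam
  obtain ⟨C, hC, hker⟩ := exists_gegenbauerKernel_gegenbauerH_le hlam hx
  refine ⟨C * (2 * (2 * lam + 1) * sinh (2 * x) ^ (2 * lam)), fun r ⟨hr, hrmin⟩ => ?_⟩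
  obtain ⟨hr1, hrx⟩ := le_min_iff.1 hrmin
  have hm := gegenbauerMeasure_gegenbauerH_pos hlam hr
  have hball := rpow_mul_gegenbauerMeasure_closedBall_le hlam hr (show r ≤ x by linarith)
  refine (norm_average_gegenbauerShift_sub_le hlam hf hr hrx (hker r ⟨hr.le, hr1⟩) a).trans ?_
  rw [← measure_smul_setAverage _ measure_closedBall_lt_top.ne, smul_eq_mul, ← mul_assoc]
  refine mul_le_mul_of_nonneg_right ?_ (integral_nonneg fun _ => norm_nonneg _)
  rw [mul_assoc, inv_mul_le_iff₀ hm, mul_assoc C]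
  exact (mul_le_mul_of_nonneg_left hball hC).trans_eq (by ring)

lemma tendsto_average_gegenbauerShift (hlam : 0 < lam)
    (hf : LocallyIntegrable (fun t => f (cosh t)) (gegenbauerMeasure lam)) (hx : 0 < x) {a : 𝕜}
    (hleb : Tendsto (fun r => ⨍ t in closedBall x r, ‖f (cosh t) - a‖ ∂gegenbauerMeasure lam)
      (𝓝[>] 0) (𝓝 0)) :
    Tendsto (fun r => ((gegenbauerMeasure lam).real (gegenbauerH 0 r))⁻¹ •
      ∫ t in gegenbauerH 0 r, gegenbauerShift lam f t x ∂gegenbauerMeasure lam)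
      (𝓝[>] 0) (𝓝 a) := by
  obtain ⟨M, hM⟩ := exists_norm_average_gegenbauerShift_sub_le hlam hf hx a
  rw [tendsto_iff_norm_sub_tendsto_zero]
  refine squeeze_zero' (Eventually.of_forall fun _ => norm_nonneg _) ?_
    (by simpa only [mul_zero] using hleb.const_mul M)
  filter_upwards [Ioc_mem_nhdsGT (by positivity : 0 < min 1 (x / 2))] with r hr using hM r hr

end Averages

end

theorem corollary1_general {𝕜 : Type*} [RCLike 𝕜] (lam : ℝ) (hlam : 0 < lam) (f : ℝ → 𝕜)
    (hf : LocallyIntegrable (fun t => f (Real.cosh t)) (gegenbauerMeasure lam)) :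
    ∀ᵐ x ∂(volume.restrict (Ici (0 : ℝ))),
      (∀ᵐ t ∂(volume.restrict (Ici (0 : ℝ))),
        IntervalIntegrable (gegenbauerShiftIntegrand lam f t x) volume 0 Real.pi) ∧
      (∀ r : ℝ, 0 < r →
        IntegrableOn (fun t => gegenbauerShift lam f t x) (gegenbauerH 0 r)
          (gegenbauerMeasure lam)) ∧
      Tendsto
        (fun r : ℝ => ((gegenbauerMeasure lam).real (gegenbauerH 0 r))⁻¹ •
          ∫ t in gegenbauerH 0 r, gegenbauerShift lam f t x ∂(gegenbauerMeasure lam))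
        (𝓝[>] 0) (𝓝 (f (Real.cosh x))) := by
  have := isLocallyFiniteMeasure_gegenbauerMeasure hlam
  have hac := restrict_Ici_absolutelyContinuous_gegenbauerMeasure lam
  refine hac ?_
  filter_upwards [(Besicovitch.vitaliFamily (gegenbauerMeasure lam)).ae_tendsto_average_norm_sub
    hf, ae_gegenbauerMeasure_pos lam] with x hleb hx
  have hconv : ∀ᵐ t ∂gegenbauerMeasure lam,
      IntervalIntegrable (gegenbauerShiftIntegrand lam f t x) volume 0 Real.pi := by
    filter_upwards [ae_integrable_gegenbauerKernel hlam hf hx.le] with t ht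
      using intervalIntegrable_gegenbauerShiftIntegrand hlam ht
  exact ⟨hac hconv, fun r _ => integrableOn_gegenbauerShift hlam hf hx.le r,
    tendsto_average_gegenbauerShift hlam hf hx (hleb.comp (Besicovitch.tendsto_filterAt _ x))⟩

theorem corollary1 {𝕜 : Type*} [RCLike 𝕜] (lam : ℝ) (hlam : 0 < lam)
    (p : ℝ≥0∞) (hp : 1 ≤ p) (f : ℝ → 𝕜) (hf : MemGegenbauerLp lam p f) :
    ∀ᵐ x ∂(volume.restrict (Ici (0 : ℝ))),
      -- the integral defining the shift converges for almost every `t ≥ 0`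
      (∀ᵐ t ∂(volume.restrict (Ici (0 : ℝ))),
        IntervalIntegrable (gegenbauerShiftIntegrand lam f t x) volume 0 Real.pi) ∧
      -- the averages over `H(0, r)` are those of an integrable function
      (∀ r : ℝ, 0 < r →
        IntegrableOn (fun t => gegenbauerShift lam f t x) (gegenbauerH 0 r)
          (gegenbauerMeasure lam)) ∧
      Tendsto
        (fun r : ℝ => ((gegenbauerMeasure lam).real (gegenbauerH 0 r))⁻¹ •
          ∫ t in gegenbauerH 0 r, gegenbauerShift lam f t x ∂(gegenbauerMeasure lam))
        (𝓝[>] 0) (𝓝 (f (Real.cosh x))) := by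
  have := isLocallyFiniteMeasure_gegenbauerMeasure hlam
  exact corollary1_general lam hlam f (MemLp.locallyIntegrable hf hp)
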